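/- A gyrogroup is a nonempty set $G$ with a binary operation $\oplus$ such that: there is a unique identity element $1\in G$ with $1\oplus g=g=g\oplus 1$ for all $g\in G$; each $g\in G$ has a unique inverse $\ominus g$ with $\ominus g\oplus g=1=g\oplus(\ominus g)$; for all $g,h\in G$ there is an automorphism $\mathrm{gyr}[g,h]$ of $(G,\oplus)$ with $g\oplus(h\oplus f)=(g\oplus h)\oplus \mathrm{gyr}[g,h](f)$ for all $f\in G$; and $\mathrm{gyr}[g,h]=\mathrm{gyr}[g\oplus h,h]$ for all $g,h\in G$. A subgyrogroup is a nonempty subset closed under $\oplus$ and $\ominus$. A strongly topologically orderable gyrogroup is a gyrogroup $G$ with a topology such that $\oplus:G\times G\to G$ and $\ominus:G\to G$ are continuous, there is a neighborhood base $\mathcal U$ at $1$ with $\mathrm{gyr}[x,y](U)=U$ for all $x,y\in G$ and $U\in\mathcal U$, and the topology of $G$ is the order topology of some total order on $G$. A subset $S\subseteq G$ is a suitable set for $G$ if $S$ is discrete in the subspace topology, $S\cup\{1\}$ is closed in $G$, and the subgyrogroup generated by $S$ is dense in $G$. Theorem. Let $G$ be a strongly topologically orderable gyrogroup in which $\{1\}$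 is a $G_\delta$-set. Then $G$ is metrizable and $G$ has a suitable set. -/

import Mathlib

open Topology

/-- A gyrogroup, written multiplicatively: `a * b` is `a ⊕ b` and `a⁻¹` is `⊖ a`. The gyration `gyr a b`
is an automorphism of the magma `(G, *)`. Uniqueness of the identity and of inverses
is automatic (see `Gyrogroup.eq_one_of_isIdentity`, `Gyrogroup.eq_inv_of_isInverse`), and the gyrations
are determined by the operation (see `Gyrogroup.gyr_unique`). -/
class Gyrogroup (G : Type*) extends One G, Mul G, Inv G where
  protected one_mul : ∀ g : G, 1 * g = g
  protected mul_one : ∀ g : G, g * 1 = g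
  protected inv_mul_cancel : ∀ g : G, g⁻¹ * g = 1
  protected mul_inv_cancel : ∀ g : G, g * g⁻¹ = 1
  /-- The gyroautomorphism `gyr[g, h]`. -/
  gyr : G → G → MulAut G
  /-- Left gyroassociative law. -/
  gyroassoc : ∀ g h f : G, g * (h * f) = (g * h) * gyr g h f
  /-- Left loop property. -/
  left_loop : ∀ g h : G, gyr g h = gyr (g * h) h

namespace Gyrogroup

variable {G : Type*} [Gyrogroup G]

theorem mul_left_cancel {a b c : G} (h : a * b = a * c) : b = c := by
  have key : ∀ x : G, a⁻¹ * (a * x) = gyr a⁻¹ a x := fun x => by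
    rw [gyroassoc, Gyrogroup.inv_mul_cancel, Gyrogroup.one_mul]
  exact (gyr a⁻¹ a).injective (by rw [← key, ← key, h])

theorem eq_one_of_isIdentity {e : G} (h : ∀ g : G, e * g = g ∧ g * e = g) : e = 1 := by
  rw [← (h 1).1, Gyrogroup.mul_one]

theorem eq_inv_of_isInverse {g x : G} (h : x * g = 1 ∧ g * x = 1) : x = g⁻¹ :=
  mul_left_cancel (h.2.trans (Gyrogroup.mul_inv_cancel g).symm)

theorem gyr_unique {g h : G} (φ : G → G) (hφ : ∀ f : G, g * (h * f) = (g * h) * φ f) :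
    φ = gyr g h := by
  funext f
  exact mul_left_cancel ((hφ f).symm.trans (gyroassoc g h f))

end Gyrogroup

/-- A subset `H` of a gyrogroup is a subgyrogroup if it is nonempty and closed under the
operation and under inversion. -/
structure IsSubgyrogroup {G : Type*} [Gyrogroup G] (H : Set G) : Prop where
  nonempty : H.Nonempty
  inv_mem : ∀ a ∈ H, a⁻¹ ∈ H
  mul_mem : ∀ a ∈ H, ∀ b ∈ H, a * b ∈ H

/-- The subgyrogroup generated by `S`: the intersection of all subgyrogroups containing `S`. -/
def generatedSubgyrogroup {G : Type*} [Gyrogroup G] (S : Set G) : Set G :=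
  ⋂₀ {H : Set G | IsSubgyrogroup H ∧ S ⊆ H}

theorem isSubgyrogroup_generatedSubgyrogroup {G : Type*} [Gyrogroup G] (S : Set G) :
    IsSubgyrogroup (generatedSubgyrogroup S) where
  nonempty := by
    refine ⟨1, fun H hH => ?_⟩
    obtain ⟨a, ha⟩ := hH.1.nonempty
    rw [← Gyrogroup.inv_mul_cancel a]
    exact hH.1.mul_mem _ (hH.1.inv_mem a ha) _ ha
  inv_mem := fun a ha H hH => hH.1.inv_mem a (ha H hH)
  mul_mem := fun a ha b hb H hH => hH.1.mul_mem a (ha H hH) b (hb H hH)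

/-- A topological gyrogroup: the operation and the inversion are continuous. -/
class TopologicalGyrogroup (G : Type*) [Gyrogroup G] [TopologicalSpace G] : Prop
    extends ContinuousMul G, ContinuousInv G

/-- A strongly topological gyrogroup: there is a neighbourhood base `𝓤` at the identity all of
whose members are invariant under all gyrations. -/
class StronglyTopologicalGyrogroup (G : Type*) [Gyrogroup G] [TopologicalSpace G] : Prop
    extends TopologicalGyrogroup G where
  exists_gyr_invariant_base : ∃ 𝓤 : Set (Set G), (𝓝 (1 : G)).HasBasis (fun U => U ∈ 𝓤) id ∧
    ∀ U ∈ 𝓤, ∀ x y : G, (fun z => Gyrogroup.gyr x y z) '' U = U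

/-- A strongly topologically orderable gyrogroup: a strongly topological gyrogroup whose topology
is the order topology of some total order (no compatibility of the order with the operation). -/
class StronglyTopologicallyOrderableGyrogroup (G : Type*) [Gyrogroup G] [TopologicalSpace G] : Prop
    extends StronglyTopologicalGyrogroup G where
  exists_linearOrder : ∃ _ : LinearOrder G, OrderTopology G

/-- A suitable set: `S` is discrete in the subspace topology, `S ∪ {1}` is closed, and the
subgyrogroup generated by `S` is dense. -/
structure IsSuitableSet {G : Type*} [Gyrogroup G] [TopologicalSpace G] (S : Set G) : Prop where
  isDiscrete : IsDiscrete S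
  isClosed : IsClosed (S ∪ {1})
  dense : Dense (generatedSubgyrogroup S)

open Filter Set

namespace Gyrogroup

variable {G : Type*} [Gyrogroup G]

/-! In an order topology a Gδ point has a countable neighbourhood base
(`IsGδ.isCountablyGenerated_nhds`). Gyration-invariant neighbourhoods of `1` absorb the failure of
associativity, so `x⁻¹ * y ∈ U` defines a uniformity, which is countably generated and hence
metrizable. For the suitable set, take a decreasing invariant base `V n` and a maximal `V
n`-separated set `A n`, inside `G` for `n = 0` and inside `V (n - 1)` afterwards. The union of the
`A n` can accumulate only at `1`, and correcting by one element of each `A n` in turn approximates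
any point within `V n`. -/

theorem inv_mul_cancel_left (a x : G) : a⁻¹ * (a * x) = x := by
  have h : gyr a⁻¹ a x = x := by
    -- The loop property turns `gyr a⁻¹ a` into `gyr 1 a`, which is trivial.
    rw [left_loop, Gyrogroup.inv_mul_cancel]
    have h := gyroassoc 1 a x
    rw [Gyrogroup.one_mul, Gyrogroup.one_mul] at h
    exact (mul_left_cancel h).symm
  rw [gyroassoc, Gyrogroup.inv_mul_cancel, Gyrogroup.one_mul, h]

theorem inv_inv' (a : G) : a⁻¹⁻¹ = a :=
  (eq_inv_of_isInverse ⟨Gyrogroup.mul_inv_cancel a, Gyrogroup.inv_mul_cancel a⟩).symm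

theorem mul_inv_cancel_left (a x : G) : a * (a⁻¹ * x) = x := by
  simpa only [inv_inv'] using inv_mul_cancel_left a⁻¹ x

/-- Source of the triangle inequality: an invariant set does not see the gyration. -/
theorem inv_mul_mul_gyr (a b c : G) : (a⁻¹ * b) * gyr a⁻¹ b (b⁻¹ * c) = a⁻¹ * c := by
  rw [← gyroassoc, mul_inv_cancel_left]

theorem inv_inv_mul (a b : G) : (a⁻¹ * b)⁻¹ = gyr a⁻¹ b (b⁻¹ * a) := by
  apply mul_left_cancel (a := a⁻¹ * b)
  rw [inv_mul_mul_gyr, Gyrogroup.mul_inv_cancel, Gyrogroup.inv_mul_cancel]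

theorem map_one (φ : MulAut G) : φ 1 = 1 := by
  apply mul_left_cancel (a := φ 1)
  rw [← map_mul, Gyrogroup.mul_one, Gyrogroup.mul_one]

theorem map_inv (φ : MulAut G) (a : G) : φ a⁻¹ = (φ a)⁻¹ := by
  apply mul_left_cancel (a := φ a)
  rw [← map_mul, Gyrogroup.mul_inv_cancel, Gyrogroup.mul_inv_cancel, map_one]

/-- Correcting an approximant `a` of `c` by `b` corrects the remainder `a⁻¹ * c` by `b`, up to a
gyration. -/
theorem mul_inv_mul_eq_gyr (a b c : G) :
    ∃ x y : G, (a * b)⁻¹ * c = gyr x y (b⁻¹ * (a⁻¹ * c)) := by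
  refine ⟨a, b, mul_left_cancel (a := a * b) ?_⟩
  rw [mul_inv_cancel_left, ← gyroassoc, mul_inv_cancel_left, mul_inv_cancel_left]

/-- A set stable under inversion and all gyrations. -/
structure IsGyrInvariant (U : Set G) : Prop where
  gyr_mem : ∀ x y, ∀ z ∈ U, gyr x y z ∈ U
  inv_mem : ∀ z ∈ U, z⁻¹ ∈ U

namespace IsGyrInvariant

variable {U : Set G}

protected theorem univ : IsGyrInvariant (univ : Set G) :=
  ⟨fun _ _ _ _ => mem_univ _, fun _ _ => mem_univ _⟩

theorem inv_mul_mem_comm (hU : IsGyrInvariant U) {a b : G} (h : a⁻¹ * b ∈ U) : b⁻¹ * a ∈ U := by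
  rw [← inv_inv' (b⁻¹ * a), inv_inv_mul b a]
  exact hU.inv_mem _ (hU.gyr_mem _ _ _ h)

theorem mul_inv_mul_mem (hU : IsGyrInvariant U) {a b c : G} (h : b⁻¹ * (a⁻¹ * c) ∈ U) :
    (a * b)⁻¹ * c ∈ U := by
  obtain ⟨x, y, hxy⟩ := mul_inv_mul_eq_gyr a b c
  exact hxy ▸ hU.gyr_mem _ _ _ h

end IsGyrInvariant

/-- Distinct points of `A` do not differ by an element of `U`. -/
def IsSeparatedBy (U A : Set G) : Prop :=
  A.Pairwise fun x y => x⁻¹ * y ∉ U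

/-- A maximal separated set covers: an uncovered point could be added to it. -/
theorem IsGyrInvariant.exists_isSeparatedBy {U : Set G} (hU : IsGyrInvariant U) (h1 : 1 ∈ U)
    (B : Set G) : ∃ A ⊆ B, IsSeparatedBy U A ∧ ∀ x ∈ B, ∃ a ∈ A, a⁻¹ * x ∈ U := by
  obtain ⟨A, hA⟩ := zorn_subset {A | A ⊆ B ∧ IsSeparatedBy U A} fun c hc hchain =>
    ⟨⋃₀ c, ⟨sUnion_subset fun A hA => (hc hA).1,
      (pairwise_sUnion hchain.directedOn).2 fun A hA => (hc hA).2⟩,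
      fun A hA => subset_sUnion_of_mem hA⟩
  refine ⟨A, hA.prop.1, hA.prop.2, fun x hx => ?_⟩
  by_contra! hfar
  have hins : insert x A ∈ {A | A ⊆ B ∧ IsSeparatedBy U A} :=
    ⟨insert_subset hx hA.prop.1, hA.prop.2.insert fun a ha _ =>
      ⟨fun h => hfar a ha (hU.inv_mul_mem_comm h), hfar a ha⟩⟩
  have hxA : x ∈ A := hA.le_of_ge hins (subset_insert x A) (mem_insert x A)
  exact hfar x hxA (by rwa [Gyrogroup.inv_mul_cancel])

/-! ### Uniformity, metrizability and the suitable set -/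

section Topology

variable [TopologicalSpace G]

theorem hasBasis_nhds_one [StronglyTopologicalGyrogroup G] :
    (𝓝 (1 : G)).HasBasis (fun U => U ∈ 𝓝 (1 : G) ∧ IsGyrInvariant U) id := by
  obtain ⟨𝓤, hb, hinv⟩ := StronglyTopologicalGyrogroup.exists_gyr_invariant_base (G := G)
  refine ⟨fun t => ⟨fun ht => ?_, fun ⟨U, hU, hUt⟩ => mem_of_superset hU.1 hUt⟩⟩
  obtain ⟨U, hU, hUt⟩ := hb.mem_iff.1 ht
  have hgyr : ∀ x y, ∀ z ∈ U, gyr x y z ∈ U := fun x y z hz =>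
    (hinv U hU x y).subset (mem_image_of_mem _ hz)
  have hmem : U ∈ 𝓝 (1 : G) := hb.mem_of_mem hU
  have hone : (1 : G)⁻¹ = 1 := by
    rw [← Gyrogroup.mul_one (1 : G)⁻¹, Gyrogroup.inv_mul_cancel]
  have hinvmem : (fun z : G => z⁻¹) ⁻¹' U ∈ 𝓝 (1 : G) :=
    continuous_inv.continuousAt.preimage_mem_nhds (by rwa [hone])
  refine ⟨U ∩ (fun z : G => z⁻¹) ⁻¹' U, ⟨inter_mem hmem hinvmem, ?_, ?_⟩,
    inter_subset_left.trans hUt⟩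
  · intro x y z hz
    refine ⟨hgyr x y z hz.1, ?_⟩
    have := hgyr x y _ hz.2
    rwa [map_inv] at this
  · intro z hz
    refine ⟨hz.2, ?_⟩
    simpa only [mem_preimage, inv_inv'] using hz.1

theorem exists_isGyrInvariant_mul_mem [StronglyTopologicalGyrogroup G] {U : Set G}
    (hU : U ∈ 𝓝 (1 : G)) :
    ∃ V ∈ 𝓝 (1 : G), IsGyrInvariant V ∧
      ∀ a b c : G, a⁻¹ * b ∈ V → b⁻¹ * c ∈ V → a⁻¹ * c ∈ U := by
  have hmul : Tendsto (fun p : G × G => p.1 * p.2) (𝓝 1 ×ˢ 𝓝 1) (𝓝 1) := by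
    have h := (continuous_mul (M := G)).tendsto (1, 1)
    rwa [nhds_prod_eq, Gyrogroup.one_mul] at h
  obtain ⟨V, ⟨hV, hVinv⟩, hVU⟩ := (hasBasis_nhds_one.prod_self.mem_iff).1 (hmul hU)
  refine ⟨V, hV, hVinv, fun a b c hab hbc => ?_⟩
  rw [← inv_mul_mul_gyr a b c]
  exact hVU (mk_mem_prod hab (hVinv.gyr_mem _ _ _ hbc))

theorem nhds_eq_comap_inv_mul [TopologicalGyrogroup G] (x : G) :
    𝓝 x = comap (fun y => x⁻¹ * y) (𝓝 1) := by
  let e : G ≃ₜ G :=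
    { toFun := fun y => x⁻¹ * y
      invFun := fun y => x * y
      left_inv := mul_inv_cancel_left x
      right_inv := inv_mul_cancel_left x
      continuous_toFun := continuous_const.mul continuous_id
      continuous_invFun := continuous_const.mul continuous_id }
  have h := e.comap_nhds_eq 1
  have hx : e.symm 1 = x := Gyrogroup.mul_one x
  rw [hx] at h
  exact h.symm

/-- The uniform structure of a strongly topological gyrogroup whose entourages are the sets
`{(x, y) | x⁻¹ * y ∈ U}` for neighbourhoods `U` of the identity. -/
abbrev leftUniformSpace (G : Type*) [Gyrogroup G] [TopologicalSpace G]
    [StronglyTopologicalGyrogroup G] : UniformSpace G :=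
  { toTopologicalSpace := ‹TopologicalSpace G›
    uniformity := comap (fun p : G × G => p.1⁻¹ * p.2) (𝓝 1)
    symm := by
      rintro s ⟨t, ht, hts⟩
      obtain ⟨U, ⟨hU, hUinv⟩, hUt⟩ := hasBasis_nhds_one.mem_iff.1 ht
      exact ⟨U, hU, fun p hp => hts (hUt (hUinv.inv_mul_mem_comm hp))⟩
    comp := by
      rintro s ⟨t, ht, hts⟩
      obtain ⟨V, hV, -, hVt⟩ := exists_isGyrInvariant_mul_mem ht
      refine (mem_lift'_sets (monotone_id.relComp monotone_id)).2 ⟨_, preimage_mem_comap hV, ?_⟩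
      rintro ⟨x, z⟩ ⟨y, hxy, hyz⟩
      exact hts (hVt x y z hxy hyz)
    nhds_eq_comap_uniformity := fun x => by
      rw [nhds_eq_comap_inv_mul, comap_comap]
      rfl }

theorem metrizableSpace_of_isCountablyGenerated [StronglyTopologicalGyrogroup G] [T0Space G]
    [(𝓝 (1 : G)).IsCountablyGenerated] : TopologicalSpace.MetrizableSpace G := by
  let := leftUniformSpace G
  have : (uniformity G).IsCountablyGenerated :=
    inferInstanceAs (comap (fun p : G × G => p.1⁻¹ * p.2) (𝓝 1)).IsCountablyGenerated
  exact UniformSpace.metrizableSpace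

theorem IsSeparatedBy.exists_nhds_inter_subsingleton [StronglyTopologicalGyrogroup G]
    {U A : Set G} (hA : IsSeparatedBy U A) (hU : U ∈ 𝓝 (1 : G)) (x : G) :
    ∃ N ∈ 𝓝 x, (N ∩ A).Subsingleton := by
  obtain ⟨V, hV, hVinv, hVU⟩ := exists_isGyrInvariant_mul_mem hU
  refine ⟨(fun y => x⁻¹ * y) ⁻¹' V, ?_, ?_⟩
  · rw [nhds_eq_comap_inv_mul]
    exact preimage_mem_comap hV
  · rintro y ⟨hy, hyA⟩ z ⟨hz, hzA⟩
    by_contra hne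
    exact hA hyA hzA hne (hVU y x z (hVinv.inv_mul_mem_comm hy) hz)

theorem exists_isSuitableSet [StronglyTopologicalGyrogroup G] [T2Space G]
    [(𝓝 (1 : G)).IsCountablyGenerated] : ∃ S : Set G, IsSuitableSet S := by
  obtain ⟨V, hVinv, hV⟩ := (hasBasis_nhds_one (G := G)).exists_antitone_subbasis
  -- The shift by one makes `B 0` all of `G`, so the approximation can start from `1`; the remainder
  -- left by `A n` lies in `V n = B (n + 1)`.
  let B : ℕ → Set G := fun n => Nat.casesOn n univ V
  have hB : ∀ n, IsGyrInvariant (B n) := by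
    rintro (_ | n)
    exacts [.univ, (hVinv n).2]
  choose A hAB hAsep hAcover using fun n =>
    (hVinv n).2.exists_isSeparatedBy (mem_of_mem_nhds (hVinv n).1) (B n)
  have hfin : ∀ x : G, x ≠ 1 → ∃ N ∈ 𝓝 x, (N ∩ ((⋃ n, A n) \ {1})).Finite := by
    intro x hx
    obtain ⟨M, N, hM, hN, hxM, h1N, hMN⟩ := t2_separation hx
    obtain ⟨n, hn⟩ := hV.mem_iff.1 (hN.mem_nhds h1N)
    choose K hK hKA using fun m =>
      (hAsep m).exists_nhds_inter_subsingleton (hVinv m).1 x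
    -- For `m > n`, `A m ⊆ V (m - 1) ⊆ V n ⊆ N` misses `M`; each of the other `A m` has at most one
    -- point in `K m`.
    refine ⟨M ∩ ⋂ m ∈ Finset.range (n + 1), K m,
      inter_mem (hM.mem_nhds hxM) ((biInter_finset_mem _).2 fun m _ => hK m), ?_⟩
    refine ((Finset.range (n + 1)).finite_toSet.biUnion fun m _ => (hKA m).finite).subset ?_
    rintro y ⟨⟨hyM, hyK⟩, hyA, -⟩
    obtain ⟨m, hym⟩ := mem_iUnion.1 hyA
    have hm : m < n + 1 := by
      by_contra! hle
      obtain ⟨k, rfl⟩ : ∃ k, m = k + 1 := ⟨m - 1, by omega⟩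
      exact disjoint_left.1 hMN hyM (hn (hV.antitone (by omega) (hAB _ hym)))
    have hm' : m ∈ Finset.range (n + 1) := Finset.mem_range.2 hm
    exact mem_biUnion hm' ⟨mem_iInter₂.1 hyK m hm', hym⟩
  refine ⟨(⋃ n, A n) \ {1}, ?_, ?_, ?_⟩
  · refine IsDiscrete.of_nhdsWithin fun x hx => ?_
    obtain ⟨N, hN, hNfin⟩ := hfin x hx.2
    have hmem : N ∩ ((N ∩ ((⋃ n, A n) \ {1})) \ {x})ᶜ ∈ 𝓝 x :=
      inter_mem hN ((hNfin.subset sdiff_subset).isClosed.isOpen_compl.mem_nhds fun h => h.2 rfl)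
    rw [le_pure_iff]
    refine mem_of_superset (inter_mem_nhdsWithin _ hmem) ?_
    rintro y ⟨hyS, hyN, hy⟩
    by_contra hne
    exact hy ⟨⟨hyN, hyS⟩, hne⟩
  · rw [← isOpen_compl_iff, isOpen_iff_mem_nhds]
    intro x hx
    have hx1 : x ≠ 1 := fun h => hx (Or.inr h)
    obtain ⟨N, hN, hNfin⟩ := hfin x hx1
    filter_upwards [hN, hNfin.isClosed.isOpen_compl.mem_nhds fun h => hx (Or.inl h.2),
      isOpen_ne.mem_nhds hx1] with y hyN hy hy1
    rintro (hyS | hyS)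
    exacts [hy ⟨hyN, hyS⟩, hy1 hyS]
  · set H := generatedSubgyrogroup ((⋃ n, A n) \ {1} : Set G)
    have hH : IsSubgyrogroup H := isSubgyrogroup_generatedSubgyrogroup _
    have hone : (1 : G) ∈ H := by
      obtain ⟨a, ha⟩ := hH.nonempty
      rw [← Gyrogroup.inv_mul_cancel a]
      exact hH.mul_mem _ (hH.inv_mem a ha) _ ha
    have hAH : ∀ n, A n ⊆ H := by
      intro n a ha
      by_cases h : a = 1
      · rwa [h]
      · exact fun K hK => hK.2 ⟨mem_iUnion.2 ⟨n, ha⟩, h⟩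
    have happrox : ∀ n, ∀ x : G, ∃ h ∈ H, h⁻¹ * x ∈ B n := by
      intro n x
      induction n with
      | zero => exact ⟨1, hone, mem_univ _⟩
      | succ n ih =>
        obtain ⟨h, hh, hx⟩ := ih
        obtain ⟨a, ha, hax⟩ := hAcover n _ hx
        exact ⟨h * a, hH.mul_mem h hh a (hAH n ha), (hB (n + 1)).mul_inv_mul_mem hax⟩
    intro x
    rw [mem_closure_iff_nhds]
    intro t ht
    rw [nhds_eq_comap_inv_mul] at ht
    obtain ⟨U, hU, hUt⟩ := ht
    obtain ⟨n, hn⟩ := hV.mem_iff.1 hU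
    obtain ⟨h, hh, hx⟩ := happrox (n + 1) x
    exact ⟨h, hUt (hn ((hB (n + 1)).inv_mul_mem_comm hx)), hh⟩

end Topology

end Gyrogroup

/-! ### First countability at a Gδ point of an ordered space -/

section Order

variable {X : Type*} [TopologicalSpace X] [LinearOrder X] [OrderTopology X]

/-- Choose `c n < x` with `Ioc (c n) x` inside the `n`th open set; a point below `x` but above every
`c n` would lie in the intersection `{x}`. -/
theorem IsGδ.exists_countable_cofinal_Iio {x : X} (hx : IsGδ ({x} : Set X)) :
    ∃ C : Set X, C.Countable ∧ C ⊆ Iio x ∧ ∀ l < x, ∃ c ∈ C, l ≤ c := by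
  by_cases hne : ∃ l, l < x
  · obtain ⟨U, hU, hxU⟩ := hx.eq_iInter_nat
    have hmem : ∀ n, x ∈ U n := fun n => mem_iInter.1 (hxU ▸ mem_singleton x) n
    choose c hcx hc using fun n => exists_Ioc_subset_of_mem_nhds ((hU n).mem_nhds (hmem n)) hne
    refine ⟨range c, countable_range c, range_subset_iff.2 hcx, fun l hl => ?_⟩
    by_contra! hlt
    have : l ∈ ({x} : Set X) := by
      rw [hxU]
      exact mem_iInter.2 fun n => hc n ⟨hlt _ (mem_range_self n), hl.le⟩
    exact hl.ne this
  · exact ⟨∅, countable_empty, empty_subset _, fun l hl => (hne ⟨l, hl⟩).elim⟩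

theorem IsGδ.isCountablyGenerated_nhds {x : X} (hx : IsGδ ({x} : Set X)) :
    (𝓝 x).IsCountablyGenerated := by
  obtain ⟨C, hC, hCx, hCcof⟩ := hx.exists_countable_cofinal_Iio
  obtain ⟨D, hD, hDx, hDcof⟩ : ∃ D : Set X, D.Countable ∧ D ⊆ Ioi x ∧
      ∀ u > x, ∃ d ∈ D, d ≤ u := IsGδ.exists_countable_cofinal_Iio (X := Xᵒᵈ) hx
  have hl : ⨅ l ∈ Iio x, 𝓟 (Ioi l) = ⨅ l ∈ C, 𝓟 (Ioi l) := by
    refine le_antisymm (biInf_mono hCx) (le_iInf₂ fun l hl => ?_)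
    obtain ⟨c, hc, hlc⟩ := hCcof l hl
    exact iInf₂_le_of_le c hc (principal_mono.2 (Ioi_subset_Ioi hlc))
  have hu : ⨅ u ∈ Ioi x, 𝓟 (Iio u) = ⨅ u ∈ D, 𝓟 (Iio u) := by
    refine le_antisymm (biInf_mono hDx) (le_iInf₂ fun u hu => ?_)
    obtain ⟨d, hd, hud⟩ := hDcof u hu
    exact iInf₂_le_of_le d hd
      (principal_mono.2 (Iio_subset_Iio hud))
  have : Countable C := hC.to_subtype
  have : Countable D := hD.to_subtype
  rw [nhds_eq_order, hl, hu, iInf_subtype', iInf_subtype']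
  infer_instance

end Order

theorem theorem4p6 {G : Type*} [Gyrogroup G] [TopologicalSpace G]
    [StronglyTopologicallyOrderableGyrogroup G] (hG : IsGδ ({1} : Set G)) :
    TopologicalSpace.MetrizableSpace G ∧ ∃ S : Set G, IsSuitableSet S := by
  obtain ⟨_, _⟩ := StronglyTopologicallyOrderableGyrogroup.exists_linearOrder (G := G)
  have := hG.isCountablyGenerated_nhds
  exact ⟨Gyrogroup.metrizableSpace_of_isCountablyGenerated, Gyrogroup.exists_isSuitableSet⟩
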